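/- Let $1\le N_T\le N_R$ be integers and $N=N_R-N_T+1$. Write ${}_1F_1(N;N_R;\sigma)=\sum_{n\ge0}A_n(\sigma)$ with $A_n(\sigma)=\frac{(N)_n}{(N_R)_n}\frac{\sigma^n}{n!}$, where $(x)_n=x(x+1)\cdots(x+n-1)$. For $a\ge0$ let $$M(s,a)=\frac1{(1-s)^N}\,{}_1F_1\!\Big(N;N_R;\frac{as}{1-s}\Big)\quad(s<1),\qquad p(t,a)=\sum_{n=0}^\infty A_n(a)\sum_{m=0}^n\binom nm\frac{(-1)^m\,t^{N+n-m-1}e^{-t}}{(N+n-m-1)!}\quad(t>0)$$ (the moment generating function and the probability density of the normalized signal-to-noise ratio, $\Gamma_1=1$, of the Rician-fading stream in MIMO zero-forcing detection with $N_T$ transmit and $N_R$ receive antennas under Rician–Rayleigh fading). Let $\mathbf p(t,a)=\big(p,\ \partial_tp,\ \partial_t^2p\big)^{\mathsf T}(t,a)$. Let $$\mathbf P(t,a)=\begin{pmatrix}0&1&0\\0&0&1\\ P_{31}&P_{32}&P_{33}\end{pmatrix},$$ $$P_{31}=\tfrac{(N_R-2)t+(N-1)(2-N_R-a)}{t^2},\quad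 P_{32}=-\tfrac{t^2+(6-2N-N_R-a)t+(N-1)(N-2)}{t^2},\quad P_{33}=-\tfrac{2t^2-(2N-4)t}{t^2},$$ and let $\mathbf Q(t,a)$ be the $3\times3$ matrix with first row $(-1,\ N-t-2,\ -t)$ and $$Q_{21}=2-N_R+\tfrac{2-2N-N_R-a+NN_R+Na}{t},\quad Q_{22}=4-2N-N_R-a+t+\tfrac{2+N^2-3N}{t},\quad Q_{23}=1-N+t,$$ $$Q_{31}=-2+N_R+\tfrac{-4+4N+2N_R+a-2NN_R-Na}{t}+\tfrac{-4+6N+2N_R+2a-3NN_R-3Na+N^2N_R+N^2a-2N^2}{t^2},$$ $$Q_{32}=3N-4+a-t+\tfrac{-6-3N^2+9N}{t}+\tfrac{-4+8N-5N^2+N^3}{t^2},\quad Q_{33}=-1+2N-N_R-a-t+\tfrac{-2-N^2+3N}{t}.$$ Then: 1. For every $a\ge0$ the series for $p(t,a)$ converges for all $t>0$, and $p(\cdot,a)$ is nonnegative and smooth on $(0,\infty)$. For every $s<1$ the series ${}_1F_1\big(N;N_R;\frac{as}{1-s}\big)$ converges, $e^{st}p(t,a)$ is integrable on $(0,\infty)$,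 and $\int_0^\infty e^{st}p(t,a)\,dt=M(s,a)$. In particular, $p(\cdot,a)$ is the probability density with moment generating function $M(\cdot,a)$. 2. For every $c\ge0$, along the line $a=ct$ the function $\tilde{\mathbf p}(u)=\mathbf p(u,cu)$ is differentiable on $(0,\infty)$ and satisfies the system of ordinary differential equations $$\tilde{\mathbf p}'(u)=\Big[\mathbf P(u,cu)+\tfrac1u\,\mathbf Q(u,cu)\Big]\tilde{\mathbf p}(u),\qquad u>0.$$ 3. (Holonomic gradient method.) For every $c\ge0$ and $0<u_0\le u_1$, any solution $\mathbf y$ of this system on $[u_0,u_1]$ with $\mathbf y(u_0)=\tilde{\mathbf p}(u_0)$ equals $\tilde{\mathbf p}$ on $[u_0,u_1]$; so solving the system numerically from the initial condition at $u_0$ computes $p(u,cu)$. -/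

import Mathlib

open scoped ContDiff

noncomputable section

namespace ZFSNR

/-- The `n`-th term `(N)_n / (NR)_n * σ ^ n / n!` of the confluent hypergeometric series. -/
def hypTerm (N NR n : ℕ) (σ : ℝ) : ℝ :=
  (ascPochhammer ℝ n).eval (N : ℝ) / (ascPochhammer ℝ n).eval (NR : ℝ) *
    (σ ^ n / (n.factorial : ℝ))

/-- The confluent hypergeometric function `₁F₁(N; NR; σ)`. -/
def confluentHyp (N NR : ℕ) (σ : ℝ) : ℝ :=
  ∑' n : ℕ, hypTerm N NR n σ

/-- The normalized SNR moment generating function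
`M(s, a) = (1 - s)⁻ᴺ ₁F₁(N; NR; a s / (1 - s))`, for `s < 1`. -/
def snrMgf (N NR : ℕ) (s a : ℝ) : ℝ :=
  1 / (1 - s) ^ N * confluentHyp N NR (a * s / (1 - s))

/-- The `n`-th term of the series for the normalized SNR density
(`N ≥ 1` and `m ≤ n`, so the natural-number subtractions are exact). -/
def pdfTerm (N NR : ℕ) (t a : ℝ) (n : ℕ) : ℝ :=
  hypTerm N NR n a * ∑ m ∈ Finset.range (n + 1),
    (n.choose m : ℝ) *
      ((-1) ^ m * t ^ (N + n - m - 1) * Real.exp (-t) / ((N + n - m - 1).factorial : ℝ))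

/-- The normalized SNR probability density `p(t, a)`, for `t > 0`. -/
def snrPdf (N NR : ℕ) (t a : ℝ) : ℝ :=
  ∑' n : ℕ, pdfTerm N NR t a n

/-- The function vector `(p, ∂ₜ p, ∂ₜ² p)` at `(t, a)`. -/
def pVec (N NR : ℕ) (t a : ℝ) : Fin 3 → ℝ :=
  fun q => iteratedDeriv (q : ℕ) (fun τ => snrPdf N NR τ a) t

/-- The companion matrix `P(t, a)`. -/
def matP (N NR : ℝ) (t a : ℝ) : Matrix (Fin 3) (Fin 3) ℝ :=
  !![0, 1, 0;
     0, 0, 1;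
     ((NR - 2) * t + (N - 1) * (2 - NR - a)) / t ^ 2,
     -((t ^ 2 + (6 - 2 * N - NR - a) * t) / t ^ 2) - (N - 1) * (N - 2) / t ^ 2,
     -((2 * t ^ 2 - (2 * N - 4) * t) / t ^ 2)]

/-- The matrix `Q(t, a)`. -/
def matQ (N NR : ℝ) (t a : ℝ) : Matrix (Fin 3) (Fin 3) ℝ :=
  !![-1, N - t - 2, -t;
     2 - NR + (2 - 2 * N - NR - a + N * NR + N * a) / t,
     4 - 2 * N - NR - a + t + (2 + N ^ 2 - 3 * N) / t,
     1 - N + t;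
     -2 + NR + (-4 + 4 * N + 2 * NR) / t + (a - 2 * N * NR - N * a) / t
       + (-4 + 6 * N + 2 * NR + 2 * a - 3 * N * NR - 3 * N * a) / t ^ 2
       + (N ^ 2 * NR + N ^ 2 * a - 2 * N ^ 2) / t ^ 2,
     3 * N - 4 + a - t + (-6 - 3 * N ^ 2 + 9 * N) / t
       + (-4 + 8 * N - 5 * N ^ 2 + N ^ 3) / t ^ 2,
     -1 + 2 * N - NR - a - t + (-2 - N ^ 2 + 3 * N) / t]

/-- The function vector on the line `a = c t`. -/
def pLine (N NR : ℕ) (c u : ℝ) : Fin 3 → ℝ :=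
  pVec N NR u (c * u)

/-- The coefficient matrix `P(u, cu) + (1/u) Q(u, cu)` of the system on the line `a = c t`. -/
def lineMatrix (N NR : ℕ) (c u : ℝ) : Matrix (Fin 3) (Fin 3) ℝ :=
  matP N NR u (c * u) + (1 / u) • matQ N NR u (c * u)

end ZFSNR

end

/-! Put `b = NR - N`. Reindexing the density by `(l, k) = (m, n - m)` gives an absolutely convergent
double series of Gamma densities of shape `N + k` with alternating weights. For fixed `k` the sum
over `l` is a `₁F₁` at `-a`, and Kummer's transformation turns it into `exp (-a)` times a series
with nonnegative coefficients. Hence (`snrPdf_eq`) `p(t, a)` is an elementary weight times the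
entire function `Φ₃(b; NR; a, a t) / Γ(NR)`, which gives smoothness and, for `a ≥ 0`, positivity.

The moment generating function comes from integrating the double series termwise: each Gamma density
contributes `(1 - s)⁻¹ ^ (N + k)`, and the binomial theorem regroups the result into `₁F₁`
(`hasSum_mixTerm_pow`).

For the differential system, `∂_y` raises the lower index of `Φ₃` by one, so `p`, `∂ₜ p`, `∂ₜ² p`
are combinations of the functions of index `NR`, `NR + 1`, `NR + 2`. On `a = c u` the arguments run
along the parabola `(c u, c u²)`; differentiating there produces at worst index `NR + 3`, which
`humbert_contiguous` eliminates. The matrix is then checked by algebra. Uniqueness is the Lipschitz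
(Grönwall) argument for linear systems. -/

noncomputable section

namespace ZFSNR

/-! ### A normalized Humbert function of two variables -/

/-- The reciprocal `1 / Γ(n)`, equal to `0` at `n = 0`. -/
def recipGamma (n : ℕ) : ℝ := (n : ℝ) / (n.factorial : ℝ)

theorem recipGamma_succ (n : ℕ) : recipGamma (n + 1) = 1 / (n.factorial : ℝ) := by
  have h : (n.factorial : ℝ) ≠ 0 := by positivity
  have h' : (n : ℝ) + 1 ≠ 0 := by positivity
  simp only [recipGamma, Nat.factorial_succ, Nat.cast_mul, Nat.cast_add, Nat.cast_one]
  field_simp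

/-- The value `0` at `n = 0` makes this hold without exception, so the contiguity relations need no
lower bound on `c`. -/
theorem mul_recipGamma_succ (n : ℕ) : (n : ℝ) * recipGamma (n + 1) = recipGamma n := by
  rw [recipGamma_succ, recipGamma]; ring

theorem recipGamma_nonneg (n : ℕ) : 0 ≤ recipGamma n := by
  unfold recipGamma; positivity

theorem recipGamma_add_le (c j k : ℕ) :
    recipGamma (c + j + k) ≤ 2 ^ (c + j + k) / (j.factorial : ℝ) := by
  unfold recipGamma
  have h1 : ((c + j + k : ℕ) : ℝ) ≤ 2 ^ (c + j + k) := by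
    exact_mod_cast (Nat.lt_two_pow_self).le
  have h2 : (j.factorial : ℝ) ≤ ((c + j + k).factorial : ℝ) := by
    exact_mod_cast Nat.factorial_le (by omega)
  gcongr

/-- The terms `(b)_j / Γ(c + j + k) * x ^ j / j! * y ^ k / k!` of the series `humbert`. -/
def humbertTerm (b c : ℕ) (x y : ℝ) (i : ℕ × ℕ) : ℝ :=
  (b.ascFactorial i.1 : ℝ) * recipGamma (c + i.1 + i.2) * (x ^ i.1 / (i.1.factorial : ℝ)) *
    (y ^ i.2 / (i.2.factorial : ℝ))

/-- The Humbert function `Φ₃(b; c; x, y) / Γ(c)`. -/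
def humbert (b c : ℕ) (x y : ℝ) : ℝ := ∑' i, humbertTerm b c x y i

theorem ascFactorial_le_factorial_mul_two_pow (b j : ℕ) :
    (b.ascFactorial j : ℝ) ≤ (j.factorial : ℝ) * 2 ^ (b + j) := by
  rw [Nat.ascFactorial_eq_factorial_mul_choose']
  push_cast
  gcongr
  have h := Nat.choose_le_two_pow (b + j - 1) j
  have h' : 2 ^ (b + j - 1) ≤ 2 ^ (b + j) := Nat.pow_le_pow_right (by norm_num) (by omega)
  exact_mod_cast h.trans h'

/-- The `j!` from the rising factorial cancels against the one in `1 / Γ(c + j + k)`. What remains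
is a product of exponential series; the `4` collects one factor `2 ^ j` from each of the two bounds.
-/
theorem abs_humbertTerm_le (b c : ℕ) (x y : ℝ) (i : ℕ × ℕ) :
    |humbertTerm b c x y i| ≤ 2 ^ (b + c) *
      ((4 * |x|) ^ i.1 / (i.1.factorial : ℝ) * ((2 * |y|) ^ i.2 / (i.2.factorial : ℝ))) := by
  obtain ⟨j, k⟩ := i
  simp only [humbertTerm, abs_mul, abs_div, abs_pow, Nat.abs_cast,
    abs_of_nonneg (recipGamma_nonneg _)]
  have hj : (j.factorial : ℝ) ≠ 0 := by positivity
  calc _ ≤ ((j.factorial : ℝ) * 2 ^ (b + j)) * (2 ^ (c + j + k) / (j.factorial : ℝ)) *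
        (|x| ^ j / (j.factorial : ℝ)) * (|y| ^ k / (k.factorial : ℝ)) := by
        gcongr
        · exact recipGamma_nonneg _
        · exact ascFactorial_le_factorial_mul_two_pow b j
        · exact recipGamma_add_le c j k
    _ = _ := by
        rw [show (4 : ℝ) = 2 * 2 by norm_num]
        simp only [mul_pow, pow_add]
        field_simp

theorem summable_exp_mul_exp (x y : ℝ) :
    Summable fun i : ℕ × ℕ => x ^ i.1 / (i.1.factorial : ℝ) * (y ^ i.2 / (i.2.factorial : ℝ)) :=
  summable_mul_of_summable_norm (Real.summable_pow_div_factorial x).norm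
    (Real.summable_pow_div_factorial y).norm

theorem summable_abs_humbertTerm (b c : ℕ) (x y : ℝ) :
    Summable fun i => |humbertTerm b c x y i| :=
  ((summable_exp_mul_exp (4 * |x|) (2 * |y|)).mul_left (2 ^ (b + c))).of_nonneg_of_le
    (fun _ => abs_nonneg _) (abs_humbertTerm_le b c x y)

theorem summable_humbertTerm (b c : ℕ) (x y : ℝ) : Summable (humbertTerm b c x y) :=
  (summable_abs_humbertTerm b c x y).of_abs

/-- Since `j ≤ 2 ^ j`, doubling `x` absorbs the extra factor. -/
theorem summable_fst_mul_humbertTerm (b c : ℕ) (x y : ℝ) :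
    Summable fun i : ℕ × ℕ => (i.1 : ℝ) * humbertTerm b c x y i := by
  refine .of_norm_bounded (summable_abs_humbertTerm b c (2 * x) y) fun i => ?_
  have h : humbertTerm b c (2 * x) y i = 2 ^ i.1 * humbertTerm b c x y i := by
    simp only [humbertTerm, mul_pow]; ring
  rw [h, Real.norm_eq_abs, abs_mul, abs_mul, Nat.abs_cast, abs_pow, Nat.abs_ofNat]
  gcongr
  exact_mod_cast (Nat.lt_two_pow_self).le

theorem summable_snd_mul_humbertTerm (b c : ℕ) (x y : ℝ) :
    Summable fun i : ℕ × ℕ => (i.2 : ℝ) * humbertTerm b c x y i := by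
  refine .of_norm_bounded (summable_abs_humbertTerm b c x (2 * y)) fun i => ?_
  have h : humbertTerm b c x (2 * y) i = 2 ^ i.2 * humbertTerm b c x y i := by
    simp only [humbertTerm, mul_pow]; ring
  rw [h, Real.norm_eq_abs, abs_mul, abs_mul, Nat.abs_cast, abs_pow, Nat.abs_ofNat]
  gcongr
  exact_mod_cast (Nat.lt_two_pow_self).le

theorem tsum_shift_fst (f : ℕ × ℕ → ℝ) (h : ∀ k, f (0, k) = 0) :
    ∑' i, f i = ∑' i : ℕ × ℕ, f (i.1 + 1, i.2) := by
  have hinj : Function.Injective fun i : ℕ × ℕ => (i.1 + 1, i.2) := by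
    rintro ⟨a, b⟩ ⟨c, d⟩ h; simpa using h
  refine (hinj.tsum_eq ?_).symm
  rintro ⟨j, k⟩ hi
  rcases j with _ | j
  · exact absurd (h k) hi
  · exact ⟨(j, k), rfl⟩

theorem tsum_shift_snd (f : ℕ × ℕ → ℝ) (h : ∀ j, f (j, 0) = 0) :
    ∑' i, f i = ∑' i : ℕ × ℕ, f (i.1, i.2 + 1) := by
  have hinj : Function.Injective fun i : ℕ × ℕ => (i.1, i.2 + 1) := by
    rintro ⟨a, b⟩ ⟨c, d⟩ h; simpa using h
  refine (hinj.tsum_eq ?_).symm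
  rintro ⟨j, k⟩ hi
  rcases k with _ | k
  · exact absurd (h j) hi
  · exact ⟨(j, k), rfl⟩

/-- `y ∂_y` acting on `humbert`. -/
theorem tsum_snd_mul_humbertTerm (b c : ℕ) (x y : ℝ) :
    ∑' i : ℕ × ℕ, (i.2 : ℝ) * humbertTerm b c x y i = y * humbert b (c + 1) x y := by
  rw [tsum_shift_snd _ (by simp), humbert, ← tsum_mul_left]
  refine tsum_congr fun i => ?_
  have h1 : (i.2 : ℝ) + 1 ≠ 0 := by positivity
  have h2 : (i.2.factorial : ℝ) ≠ 0 := by positivity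
  simp only [humbertTerm, Nat.factorial_succ]
  rw [show c + i.1 + (i.2 + 1) = c + 1 + i.1 + i.2 by ring]
  push_cast
  field_simp
  ring

/-- `x ∂_x` acting on `humbert`, in terms of `x ∂_x` acting on its contiguous function. -/
theorem tsum_fst_mul_humbertTerm (b c : ℕ) (x y : ℝ) :
    ∑' i : ℕ × ℕ, (i.1 : ℝ) * humbertTerm b c x y i =
      x * (b * humbert b (c + 1) x y +
        ∑' i : ℕ × ℕ, (i.1 : ℝ) * humbertTerm b (c + 1) x y i) := by
  rw [tsum_shift_fst _ (by simp), humbert, ← tsum_mul_left,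
    ← ((summable_humbertTerm b (c + 1) x y).mul_left _).tsum_add
      (summable_fst_mul_humbertTerm b (c + 1) x y), ← tsum_mul_left]
  refine tsum_congr fun i => ?_
  have h1 : (i.1 : ℝ) + 1 ≠ 0 := by positivity
  have h2 : (i.1.factorial : ℝ) ≠ 0 := by positivity
  simp only [humbertTerm, Nat.factorial_succ, Nat.ascFactorial_succ]
  rw [show c + (i.1 + 1) + i.2 = c + 1 + i.1 + i.2 by ring]
  push_cast
  field_simp
  ring

/-- The Euler operator `x ∂_x + y ∂_y` lowers the index `c`. -/
theorem tsum_fst_mul_humbertTerm_succ (b c : ℕ) (x y : ℝ) :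
    ∑' i : ℕ × ℕ, (i.1 : ℝ) * humbertTerm b (c + 1) x y i =
      humbert b c x y - c * humbert b (c + 1) x y - y * humbert b (c + 2) x y := by
  have h : humbert b c x y = c * humbert b (c + 1) x y +
      ∑' i : ℕ × ℕ, (i.1 : ℝ) * humbertTerm b (c + 1) x y i +
      ∑' i : ℕ × ℕ, (i.2 : ℝ) * humbertTerm b (c + 1) x y i := by
    have hs := (summable_humbertTerm b (c + 1) x y).mul_left (c : ℝ)
    have hf := summable_fst_mul_humbertTerm b (c + 1) x y
    rw [humbert, humbert, ← tsum_mul_left, ← hs.tsum_add hf,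
      ← (hs.add hf).tsum_add (summable_snd_mul_humbertTerm b (c + 1) x y)]
    refine tsum_congr fun i => ?_
    have h := mul_recipGamma_succ (c + i.1 + i.2)
    simp only [humbertTerm]
    rw [← h, show c + 1 + i.1 + i.2 = c + i.1 + i.2 + 1 by ring]
    push_cast
    ring
  rw [tsum_snd_mul_humbertTerm] at h
  linarith

/-- The four-term contiguity relation of `humbert` in the index `c`. -/
theorem humbert_contiguous (b c : ℕ) (x y : ℝ) :
    humbert b c x y = (c + x) * humbert b (c + 1) x y +
      (y + x * ((b : ℝ) - c - 1)) * humbert b (c + 2) x y - x * y * humbert b (c + 3) x y := by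
  -- The shift recursion relates `x ∂_x` at two consecutive indices; the Euler relation evaluates
  -- both, leaving only values of `humbert`.
  have h := tsum_fst_mul_humbertTerm b (c + 1) x y
  rw [tsum_fst_mul_humbertTerm_succ, tsum_fst_mul_humbertTerm_succ] at h
  push_cast at h
  linear_combination h

/-! ### Differentiation of the series -/

theorem natCast_mul_pow_pred_le (n : ℕ) {r R : ℝ} (hr : 0 ≤ r) (h : r ≤ R) :
    (n : ℝ) * r ^ (n - 1) ≤ (2 * (R + 1)) ^ n := by
  have h1 : (n : ℝ) ≤ 2 ^ n := by exact_mod_cast (Nat.lt_two_pow_self).le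
  have h2 : r ^ (n - 1) ≤ (R + 1) ^ n :=
    (pow_le_pow_left₀ hr (by linarith : r ≤ R + 1) _).trans
      (pow_le_pow_right₀ (by linarith) (Nat.sub_le n 1))
  rw [mul_pow]
  gcongr

/-- On the ball of radius `|u| + 1` the differentiated terms are dominated by the series at `2 *
(|u| + 2)`. Exponents may repeat, so one lemma serves both differentiation in `t` and along the
parabola. -/
theorem hasDerivAt_tsum_mul_pow {ι : Type*} (C : ι → ℝ) (n : ι → ℕ)
    (hC : ∀ R : ℝ, Summable fun i => |C i * R ^ n i|) (u : ℝ) :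
    HasDerivAt (fun v => ∑' i, C i * v ^ n i) (∑' i, C i * (n i * u ^ (n i - 1))) u := by
  refine hasDerivAt_tsum_of_isPreconnected (hC (2 * (|u| + 1 + 1))) (t := Metric.ball 0 (|u| + 1))
    (y₀ := u) Metric.isOpen_ball (convex_ball _ _).isPreconnected
    (fun i v _ => (hasDerivAt_pow (n i) v).const_mul (C i)) (fun i v hv => ?_) ?_ (hC u).of_abs ?_
  · rw [mem_ball_zero_iff, Real.norm_eq_abs] at hv
    rw [norm_mul, norm_mul, norm_pow, Real.norm_natCast, Real.norm_eq_abs, Real.norm_eq_abs,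
      abs_mul, abs_of_nonneg (a := (2 * (|u| + 1 + 1)) ^ n i) (by positivity)]
    gcongr
    exact natCast_mul_pow_pred_le _ (abs_nonneg v) hv.le
  all_goals simp

theorem hasDerivAt_humbert_mul_right (b c : ℕ) (x y t : ℝ) :
    HasDerivAt (fun τ => humbert b c x (y * τ)) (y * humbert b (c + 1) x (y * t)) t := by
  have hterm : ∀ τ (i : ℕ × ℕ),
      humbertTerm b c x (y * τ) i = humbertTerm b c x y i * τ ^ i.2 := fun τ i => by
    simp only [humbertTerm, mul_pow]; ring
  have h := hasDerivAt_tsum_mul_pow (humbertTerm b c x y) (fun i => i.2)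
    (fun R => by simpa only [hterm] using summable_abs_humbertTerm b c x (y * R)) t
  simp only [← hterm] at h
  refine h.congr_deriv ?_
  rw [tsum_shift_snd _ (by simp), humbert, ← tsum_mul_left]
  refine tsum_congr fun i => ?_
  have h1 : (i.2 : ℝ) + 1 ≠ 0 := by positivity
  have h2 : (i.2.factorial : ℝ) ≠ 0 := by positivity
  simp only [humbertTerm, Nat.factorial_succ, Nat.add_sub_cancel]
  rw [show c + i.1 + (i.2 + 1) = c + 1 + i.1 + i.2 by ring]
  push_cast
  field_simp
  ring

theorem contDiff_humbert_mul_right (b c : ℕ) (x y : ℝ) :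
    ContDiff ℝ ∞ fun τ => humbert b c x (y * τ) := by
  rw [contDiff_infty]
  intro n
  induction n generalizing c with
  | zero =>
    exact contDiff_zero.2 (continuous_iff_continuousAt.2 fun t =>
      (hasDerivAt_humbert_mul_right b c x y t).continuousAt)
  | succ n ih =>
    have hd : deriv (fun τ => humbert b c x (y * τ)) =
        fun t => y * humbert b (c + 1) x (y * t) :=
      funext fun t => (hasDerivAt_humbert_mul_right b c x y t).deriv
    rw [Nat.cast_succ, contDiff_succ_iff_deriv, hd]
    exact ⟨fun t => (hasDerivAt_humbert_mul_right b c x y t).differentiableAt, by simp,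
      contDiff_const.mul (ih (c + 1))⟩

/-- The derivative of `humbert` along the parabola `(x, y) = (r u, r u²)`, where
`u d/du = x ∂_x + 2 y ∂_y`. -/
theorem hasDerivAt_humbert_parabola (b c : ℕ) (r : ℝ) {u : ℝ} (hu : u ≠ 0) :
    HasDerivAt (fun v => humbert b c (r * v) (r * v * v))
      (((∑' i : ℕ × ℕ, (i.1 : ℝ) * humbertTerm b c (r * u) (r * u * u) i) +
        2 * (r * u * u) * humbert b (c + 1) (r * u) (r * u * u)) / u) u := by
  have hterm : ∀ v (i : ℕ × ℕ),
      humbertTerm b c (r * v) (r * v * v) i = humbertTerm b c r r i * v ^ (i.1 + 2 * i.2) :=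
    fun v i => by simp only [humbertTerm, mul_pow, pow_add, pow_mul, sq]; ring
  have h := hasDerivAt_tsum_mul_pow (humbertTerm b c r r) (fun i => i.1 + 2 * i.2)
    (fun R => by simpa only [hterm] using summable_abs_humbertTerm b c (r * R) (r * R * R)) u
  simp only [← hterm] at h
  refine h.congr_deriv ?_
  rw [eq_div_iff hu, mul_assoc 2, ← tsum_snd_mul_humbertTerm, ← tsum_mul_left,
    ← (summable_fst_mul_humbertTerm b c _ _).tsum_add
      ((summable_snd_mul_humbertTerm b c _ _).mul_left 2), ← tsum_mul_right]
  refine tsum_congr fun i => ?_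
  rw [hterm]
  -- The exponent minus one is truncated at `0`, where the factor in front vanishes.
  rcases h0 : i.1 + 2 * i.2 with _ | m
  · have h1 : i.1 = 0 := by omega
    have h2 : i.2 = 0 := by omega
    simp [h1, h2]
  · have h3 : (i.1 : ℝ) + 2 * i.2 = m + 1 := by exact_mod_cast h0
    simp only [Nat.add_sub_cancel, pow_succ]
    push_cast
    linear_combination -(humbertTerm b c r r i * u ^ m * u) * h3

/-! ### Kummer's transformation -/

/-- The quotient `(N)_n / (NR)_n` of rising factorials. -/
def pochRatio (N NR n : ℕ) : ℝ := (N.ascFactorial n : ℝ) / (NR.ascFactorial n : ℝ)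

theorem hypTerm_eq (N NR n : ℕ) (σ : ℝ) :
    hypTerm N NR n σ = pochRatio N NR n * (σ ^ n / (n.factorial : ℝ)) := by
  rw [hypTerm, pochRatio, Nat.cast_ascFactorial, Nat.cast_ascFactorial]

theorem ascFactorial_ne_zero {n : ℕ} (hn : 1 ≤ n) (k : ℕ) : (n.ascFactorial k : ℝ) ≠ 0 := by
  obtain ⟨m, rfl⟩ := Nat.exists_eq_add_of_le' hn
  exact_mod_cast (Nat.ascFactorial_pos m k).ne'

theorem pochRatio_nonneg (N NR n : ℕ) : 0 ≤ pochRatio N NR n := by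
  unfold pochRatio; positivity

theorem pochRatio_le_one {N NR : ℕ} (h : N ≤ NR) (n : ℕ) : pochRatio N NR n ≤ 1 :=
  div_le_one_of_le₀ (by exact_mod_cast Nat.ascFactorial_le n h) (by positivity)

theorem pochRatio_zero (N NR : ℕ) : pochRatio N NR 0 = 1 := by simp [pochRatio]

theorem pochRatio_add (N NR k l : ℕ) :
    pochRatio N NR (k + l) = pochRatio N NR k * pochRatio (N + k) (NR + k) l := by
  simp only [pochRatio, ← Nat.ascFactorial_mul_ascFactorial]
  push_cast
  rw [div_mul_div_comm]

theorem pochRatio_one (N NR : ℕ) : pochRatio N NR 1 = (N : ℝ) / NR := by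
  simp [pochRatio, Nat.ascFactorial_succ]

/-- The Chu–Vandermonde identity. -/
theorem sum_choose_mul_neg_one_pow_mul_pochRatio (b n : ℕ) : ∀ {N : ℕ}, 1 ≤ N →
    ∑ m ∈ Finset.range (n + 1), (n.choose m : ℝ) * ((-1) ^ m * pochRatio N (N + b) m) =
      pochRatio b (N + b) n := by
  induction n with
  | zero => intro N _; simp [pochRatio_zero]
  | succ n ih =>
    intro N hN
    -- Pascal's rule leaves the sum for `n` at `N` and a multiple of the one at `N + 1`, hence the
    -- induction over all `N`.
    rw [Finset.sum_choose_succ_mul (fun m _ => (-1 : ℝ) ^ m * pochRatio N (N + b) m), ih hN]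
    have h : ∀ m, (-1 : ℝ) ^ (m + 1) * pochRatio N (N + b) (m + 1) =
        -((N : ℝ) / (N + b : ℕ)) * ((-1) ^ m * pochRatio (N + 1) (N + 1 + b) m) := fun m => by
      rw [add_comm m 1, pochRatio_add, pochRatio_one, show N + b + 1 = N + 1 + b by ring]
      ring
    simp only [h, mul_left_comm _ (-((N : ℝ) / (N + b : ℕ))), ← Finset.mul_sum]
    rw [ih (by omega)]
    have h1 := ascFactorial_ne_zero (show 1 ≤ N + b by omega) n
    have h2 := ascFactorial_ne_zero (show 1 ≤ N + 1 + b by omega) n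
    have h3 : ((N + b : ℕ) : ℝ) ≠ 0 := by positivity
    have h4 : ((N + b + n : ℕ) : ℝ) ≠ 0 := by positivity
    have h5 : ((N + b : ℕ) : ℝ) * ((N + 1 + b).ascFactorial n : ℝ) =
        ((N + b + n : ℕ) : ℝ) * ((N + b).ascFactorial n : ℝ) := by
      have := Nat.succ_ascFactorial (N + b) n
      rw [show (N + b).succ = N + 1 + b by omega] at this
      exact_mod_cast this
    have h6 : ((N + 1 + b).ascFactorial n : ℝ) =
        ((N + b + n : ℕ) : ℝ) * ((N + b).ascFactorial n : ℝ) / ((N + b : ℕ) : ℝ) := by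
      rw [← h5]; field_simp
    simp only [pochRatio, Nat.ascFactorial_succ, h6, Nat.cast_mul]
    field_simp
    push_cast
    ring

theorem summable_abs_pochRatio_mul_exp {N NR : ℕ} (h : N ≤ NR) (x : ℝ) :
    Summable fun n => |pochRatio N NR n * (x ^ n / (n.factorial : ℝ))| := by
  refine (Real.summable_pow_div_factorial x).abs.of_nonneg_of_le (fun _ => abs_nonneg _)
    fun n => ?_
  rw [abs_mul, abs_of_nonneg (pochRatio_nonneg _ _ _)]
  exact mul_le_of_le_one_left (abs_nonneg _) (pochRatio_le_one h n)

/-- Kummer's transformation: in the Cauchy product of the left side with `exp a`, the coefficients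
are Chu–Vandermonde sums. -/
theorem tsum_pochRatio_mul_exp_neg {N : ℕ} (hN : 1 ≤ N) (b : ℕ) (a : ℝ) :
    ∑' n, pochRatio N (N + b) n * ((-a) ^ n / (n.factorial : ℝ)) =
      Real.exp (-a) * ∑' n, pochRatio b (N + b) n * (a ^ n / (n.factorial : ℝ)) := by
  have hexp : Real.exp a = ∑' n : ℕ, a ^ n / (n.factorial : ℝ) := by
    rw [Real.exp_eq_exp_ℝ, NormedSpace.exp_eq_tsum_div]
  have h := tsum_mul_tsum_eq_tsum_sum_range_of_summable_norm
    (f := fun n => pochRatio N (N + b) n * ((-a) ^ n / (n.factorial : ℝ)))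
    (g := fun n => a ^ n / (n.factorial : ℝ)) (summable_abs_pochRatio_mul_exp (N.le_add_right b) (-a))
    (Real.summable_pow_div_factorial a).norm
  rw [← hexp] at h
  rw [Real.exp_neg, eq_inv_mul_iff_mul_eq₀ (Real.exp_ne_zero a), mul_comm, h]
  refine tsum_congr fun n => ?_
  rw [← sum_choose_mul_neg_one_pow_mul_pochRatio b n hN, Finset.sum_mul]
  refine Finset.sum_congr rfl fun m hm => ?_
  have hm : m ≤ n := Nat.lt_succ_iff.1 (Finset.mem_range.1 hm)
  rw [Nat.cast_choose ℝ hm, neg_pow]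
  obtain ⟨k, rfl⟩ := Nat.exists_eq_add_of_le hm
  rw [Nat.add_sub_cancel_left, pow_add]
  have h1 : (m.factorial : ℝ) ≠ 0 := by positivity
  have h2 : (k.factorial : ℝ) ≠ 0 := by positivity
  have h3 : ((m + k).factorial : ℝ) ≠ 0 := by positivity
  field_simp

/-! ### Double series obtained by expanding the finite sums -/

/-- The terms of the double series obtained by expanding the finite sums in
`∑' n, hypTerm N NR n a * ∑ m ≤ n, (n.choose m) * ((-1) ^ m * g (n - m))`. -/
def mixTerm (N NR : ℕ) (a : ℝ) (g : ℕ → ℝ) (i : ℕ × ℕ) : ℝ :=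
  pochRatio N NR (i.2 + i.1) * ((-a) ^ i.1 / (i.1.factorial : ℝ)) *
    (a ^ i.2 / (i.2.factorial : ℝ)) * g i.2

theorem abs_mixTerm_le {N NR : ℕ} (h : N ≤ NR) (a : ℝ) (g : ℕ → ℝ) (i : ℕ × ℕ) :
    |mixTerm N NR a g i| ≤ |a| ^ i.1 / (i.1.factorial : ℝ) *
      (|a| ^ i.2 / (i.2.factorial : ℝ)) * |g i.2| := by
  simp only [mixTerm, abs_mul, abs_div, abs_pow, abs_neg, Nat.abs_cast,
    abs_of_nonneg (pochRatio_nonneg _ _ _)]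
  gcongr
  exact mul_le_of_le_one_left (by positivity) (pochRatio_le_one h _)

theorem hypTerm_mul_sum_eq (N NR n : ℕ) (a : ℝ) (g : ℕ → ℝ) :
    hypTerm N NR n a *
        ∑ m ∈ Finset.range (n + 1), (n.choose m : ℝ) * ((-1) ^ m * g (n - m)) =
      ∑ i ∈ Finset.HasAntidiagonal.antidiagonal n, mixTerm N NR a g i := by
  rw [Finset.Nat.sum_antidiagonal_eq_sum_range_succ_mk, Finset.mul_sum]
  refine Finset.sum_congr rfl fun m hm => ?_
  have hm : m ≤ n := Nat.lt_succ_iff.1 (Finset.mem_range.1 hm)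
  rw [Nat.cast_choose ℝ hm, hypTerm_eq]
  obtain ⟨k, rfl⟩ := Nat.exists_eq_add_of_le hm
  simp only [mixTerm, Nat.add_sub_cancel_left]
  rw [neg_pow a, pow_add, add_comm k m]
  have h1 : (m.factorial : ℝ) ≠ 0 := by positivity
  have h2 : (k.factorial : ℝ) ≠ 0 := by positivity
  have h3 : ((m + k).factorial : ℝ) ≠ 0 := by positivity
  field_simp

theorem hasSum_antidiagonal {f : ℕ × ℕ → ℝ} (hf : Summable f) :
    HasSum (fun n => ∑ i ∈ Finset.HasAntidiagonal.antidiagonal n, f i) (∑' i, f i) := by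
  refine HasSum.sigma
    (Finset.HasAntidiagonal.sigmaAntidiagonalEquivProd.hasSum_iff.2 hf.hasSum) fun n => ?_
  rw [← Finset.sum_coe_sort]
  exact hasSum_fintype _

theorem hasSum_hypTerm_mul_sum {N NR : ℕ} {a : ℝ} {g : ℕ → ℝ}
    (h : Summable (mixTerm N NR a g)) :
    HasSum (fun n => hypTerm N NR n a *
        ∑ m ∈ Finset.range (n + 1), (n.choose m : ℝ) * ((-1) ^ m * g (n - m)))
      (∑' i, mixTerm N NR a g i) := by
  simpa only [hypTerm_mul_sum_eq] using hasSum_antidiagonal h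

/-! ### The density in closed form -/

/-- The Gamma density of shape `N + k` and unit rate. -/
def gammaDensity (N : ℕ) (t : ℝ) (k : ℕ) : ℝ :=
  t ^ (N + k - 1) * Real.exp (-t) / ((N + k - 1).factorial : ℝ)

theorem gammaDensity_nonneg (N k : ℕ) {t : ℝ} (ht : 0 ≤ t) : 0 ≤ gammaDensity N t k := by
  unfold gammaDensity; positivity

theorem gammaDensity_le_one (N k : ℕ) {t : ℝ} (ht : 0 ≤ t) : gammaDensity N t k ≤ 1 := by
  have h := Real.pow_div_factorial_le_exp t ht (N + k - 1)
  rw [gammaDensity, Real.exp_neg, mul_div_right_comm, ← div_eq_mul_inv]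
  exact div_le_one_of_le₀ h (Real.exp_pos t).le

theorem summable_mixTerm_gammaDensity {N NR : ℕ} (h : N ≤ NR) (a : ℝ) {t : ℝ} (ht : 0 ≤ t) :
    Summable (mixTerm N NR a (gammaDensity N t)) := by
  refine .of_norm_bounded (summable_exp_mul_exp |a| |a|) fun i =>
    (abs_mixTerm_le h a _ i).trans ?_
  rw [abs_of_nonneg (gammaDensity_nonneg N _ ht)]
  exact mul_le_of_le_one_right (by positivity) (gammaDensity_le_one N _ ht)

theorem pdfTerm_eq {N : ℕ} (NR : ℕ) (t a : ℝ) (n : ℕ) :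
    pdfTerm N NR t a n = hypTerm N NR n a * ∑ m ∈ Finset.range (n + 1),
      (n.choose m : ℝ) * ((-1) ^ m * gammaDensity N t (n - m)) := by
  rw [pdfTerm]
  congr 1
  refine Finset.sum_congr rfl fun m hm => ?_
  have hm : m ≤ n := Nat.lt_succ_iff.1 (Finset.mem_range.1 hm)
  rw [gammaDensity, Nat.add_sub_assoc hm]
  ring

theorem hasSum_pdfTerm {N NR : ℕ} (h : N ≤ NR) (a : ℝ) {t : ℝ} (ht : 0 ≤ t) :
    HasSum (pdfTerm N NR t a) (∑' i, mixTerm N NR a (gammaDensity N t) i) := by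
  simpa only [← pdfTerm_eq] using hasSum_hypTerm_mul_sum (summable_mixTerm_gammaDensity h a ht)

/-- The factor in front of the Humbert function in the closed form of the density. -/
def pdfWeight (N b : ℕ) (t a : ℝ) : ℝ :=
  ((N + b - 1).factorial : ℝ) / ((N - 1).factorial : ℝ) * Real.exp (-a) *
    (Real.exp (-t) * t ^ (N - 1))

/-- Here `(N)_k` cancels in `(N + k - 1)!`, while `(N + b)_k (N + b + k)_j` merges into `Γ(N + b + j
+ k) / Γ(N + b)`. -/
theorem pochRatio_mul_gammaDensity_eq {N : ℕ} (hN : 1 ≤ N) (b : ℕ) (t a : ℝ) (j k : ℕ) :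
    pochRatio N (N + b) k * (a ^ k / (k.factorial : ℝ)) * gammaDensity N t k *
        (Real.exp (-a) * (pochRatio b (N + k + b) j * (a ^ j / (j.factorial : ℝ)))) =
      pdfWeight N b t a * humbertTerm b (N + b) a (a * t) (j, k) := by
  have e1 : (((N + k - 1).factorial : ℕ) : ℝ) = (N - 1).factorial * N.ascFactorial k := by
    exact_mod_cast (Nat.factorial_mul_ascFactorial' N k hN).symm
  have e2 : recipGamma (N + b + j + k) = 1 / (((N + b - 1).factorial : ℝ) *
      (((N + b).ascFactorial k : ℝ) * ((N + k + b).ascFactorial j : ℝ))) := by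
    have h := Nat.factorial_mul_ascFactorial' (N + b) (k + j) (by omega)
    rw [← Nat.ascFactorial_mul_ascFactorial, show N + b + k = N + k + b by ring] at h
    rw [show N + b + j + k = (N + b + (k + j) - 1) + 1 by omega, recipGamma_succ, ← h]
    push_cast
    rfl
  have h1 := ascFactorial_ne_zero hN k
  have h2 := ascFactorial_ne_zero (show 1 ≤ N + b by omega) k
  have h3 := ascFactorial_ne_zero (show 1 ≤ N + k + b by omega) j
  have h4 : ((N - 1).factorial : ℝ) ≠ 0 := by positivity
  have h5 : ((N + b - 1).factorial : ℝ) ≠ 0 := by positivity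
  have h6 : t ^ (N + k - 1) = t ^ (N - 1) * t ^ k := by
    rw [← pow_add]; congr 1; omega
  simp only [pochRatio, gammaDensity, pdfWeight, humbertTerm, e1, e2, h6, mul_pow]
  field_simp

/-- For fixed `k`, splitting `(N)_{k+l}` and `(NR)_{k+l}` at `k` leaves a Kummer series with
parameters `N + k` and `N + k + b`, whose difference is still `b`. -/
theorem snrPdf_eq {N : ℕ} (hN : 1 ≤ N) (b : ℕ) (a : ℝ) {t : ℝ} (ht : 0 ≤ t) :
    snrPdf N (N + b) t a = pdfWeight N b t a * humbert b (N + b) a (a * t) := by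
  have hs := summable_mixTerm_gammaDensity (N.le_add_right b) a ht
  have hH := summable_humbertTerm b (N + b) a (a * t)
  rw [snrPdf, (hasSum_pdfTerm (N.le_add_right b) a ht).tsum_eq, hs.tsum_prod, humbert,
    hH.tsum_prod, ← Summable.tsum_comm (f := fun j k => humbertTerm b (N + b) a (a * t) (j, k)) hH,
    ← Summable.tsum_comm (f := fun l k => mixTerm N (N + b) a (gammaDensity N t) (l, k)) hs,
    ← tsum_mul_left]
  refine tsum_congr fun k => ?_
  have h1 : ∀ l, mixTerm N (N + b) a (gammaDensity N t) (l, k) =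
      pochRatio N (N + b) k * (a ^ k / (k.factorial : ℝ)) * gammaDensity N t k *
        (pochRatio (N + k) (N + k + b) l * ((-a) ^ l / (l.factorial : ℝ))) := fun l => by
    simp only [mixTerm, pochRatio_add]
    rw [show N + b + k = N + k + b by ring]
    ring
  simp only [h1]
  rw [tsum_mul_left, tsum_pochRatio_mul_exp_neg (by omega), ← tsum_mul_left, ← tsum_mul_left,
    ← tsum_mul_left]
  exact tsum_congr fun j => pochRatio_mul_gammaDensity_eq hN b t a j k

theorem humbert_nonneg (b c : ℕ) {x y : ℝ} (hx : 0 ≤ x) (hy : 0 ≤ y) : 0 ≤ humbert b c x y :=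
  tsum_nonneg fun i => by
    have := recipGamma_nonneg (c + i.1 + i.2)
    unfold humbertTerm
    positivity

theorem snrPdf_nonneg {N : ℕ} (hN : 1 ≤ N) (b : ℕ) {a t : ℝ} (ha : 0 ≤ a) (ht : 0 ≤ t) :
    0 ≤ snrPdf N (N + b) t a := by
  rw [snrPdf_eq hN b a ht]
  refine mul_nonneg ?_ (humbert_nonneg _ _ ha (mul_nonneg ha ht))
  unfold pdfWeight
  positivity

theorem contDiffOn_snrPdf {N : ℕ} (hN : 1 ≤ N) (b : ℕ) (a : ℝ) :
    ContDiffOn ℝ ∞ (fun t => snrPdf N (N + b) t a) (Set.Ioi 0) := by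
  have h : ContDiff ℝ ∞ fun t => pdfWeight N b t a * humbert b (N + b) a (a * t) := by
    refine ContDiff.mul ?_ (contDiff_humbert_mul_right b (N + b) a a)
    unfold pdfWeight
    fun_prop
  exact h.contDiffOn.congr fun t ht => snrPdf_eq hN b a (Set.mem_Ioi.1 ht).le

/-! ### The moment generating function -/

theorem integral_pow_mul_exp_neg_mul_Ioi (n : ℕ) {r : ℝ} (hr : 0 < r) :
    ∫ t in Set.Ioi (0 : ℝ), t ^ n * Real.exp (-(r * t)) = n.factorial / r ^ (n + 1) := by
  have h := Real.integral_rpow_mul_exp_neg_mul_Ioi (a := (n : ℝ) + 1) (by positivity) hr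
  rw [Real.Gamma_nat_eq_factorial, add_sub_cancel_right] at h
  simp only [Real.rpow_natCast] at h
  rw [h, ← Nat.cast_succ, Real.rpow_natCast, one_div, inv_pow, div_eq_inv_mul]

theorem integrableOn_pow_mul_exp_neg_mul_Ioi (n : ℕ) {r : ℝ} (hr : 0 < r) :
    MeasureTheory.IntegrableOn (fun t : ℝ => t ^ n * Real.exp (-(r * t))) (Set.Ioi 0) := by
  -- A non-integrable function has integral `0` by convention, so a nonzero value proves
  -- integrability.
  refine MeasureTheory.Integrable.of_integral_ne_zero ?_
  rw [integral_pow_mul_exp_neg_mul_Ioi n hr]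
  positivity

theorem exp_mul_gammaDensity_eq (N k : ℕ) (s t : ℝ) :
    Real.exp (s * t) * gammaDensity N t k =
      1 / ((N + k - 1).factorial : ℝ) * (t ^ (N + k - 1) * Real.exp (-((1 - s) * t))) := by
  rw [show -((1 - s) * t) = s * t + -t by ring, Real.exp_add, gammaDensity]
  ring

theorem integrableOn_exp_mul_gammaDensity (N k : ℕ) {s : ℝ} (hs : s < 1) :
    MeasureTheory.IntegrableOn (fun t => Real.exp (s * t) * gammaDensity N t k) (Set.Ioi 0) := by
  simp only [exp_mul_gammaDensity_eq]
  exact (integrableOn_pow_mul_exp_neg_mul_Ioi (N + k - 1) (sub_pos.2 hs)).const_mul _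

theorem integral_exp_mul_gammaDensity {N : ℕ} (hN : 1 ≤ N) (k : ℕ) {s : ℝ} (hs : s < 1) :
    ∫ t in Set.Ioi (0 : ℝ), Real.exp (s * t) * gammaDensity N t k = (1 / (1 - s)) ^ (N + k) := by
  simp only [exp_mul_gammaDensity_eq]
  rw [MeasureTheory.integral_const_mul,
    integral_pow_mul_exp_neg_mul_Ioi (N + k - 1) (sub_pos.2 hs),
    show N + k - 1 + 1 = N + k by omega, one_div_pow]
  field_simp

theorem integrable_tsum_of_summable_integral_norm {α ι : Type*} [MeasurableSpace α]
    {μ : MeasureTheory.Measure α} [Countable ι] {F : ι → α → ℝ}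
    (hF : ∀ i, MeasureTheory.Integrable (F i) μ) (hsum : Summable fun i => ∫ x, ‖F i x‖ ∂μ)
    (hm : MeasureTheory.AEStronglyMeasurable (fun x => ∑' i, F i x) μ) :
    MeasureTheory.Integrable (fun x => ∑' i, F i x) μ := by
  refine ⟨hm, ?_⟩
  calc ∫⁻ x, ‖∑' i, F i x‖ₑ ∂μ ≤ ∫⁻ x, ∑' i, ‖F i x‖ₑ ∂μ :=
        MeasureTheory.lintegral_mono fun x => enorm_tsum_le_tsum_enorm
    _ = ∑' i, ENNReal.ofReal (∫ x, ‖F i x‖ ∂μ) := by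
        rw [MeasureTheory.lintegral_tsum fun i => (hF i).aestronglyMeasurable.enorm]
        simp only [MeasureTheory.ofReal_integral_norm_eq_lintegral_enorm (hF _)]
    _ < ⊤ := hsum.tsum_ofReal_ne_top.lt_top

theorem exp_mul_mixTerm_eq (N NR : ℕ) (a s t : ℝ) (i : ℕ × ℕ) :
    Real.exp (s * t) * mixTerm N NR a (gammaDensity N t) i =
      mixTerm N NR a (fun _ => 1) i * (Real.exp (s * t) * gammaDensity N t i.2) := by
  simp only [mixTerm]; ring

theorem summable_mixTerm_pow {N NR : ℕ} (h : N ≤ NR) (a x : ℝ) :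
    Summable fun i => |mixTerm N NR a (fun k => x ^ (N + k)) i| := by
  refine ((summable_exp_mul_exp |a| (|a| * |x|)).mul_left (|x| ^ N)).of_nonneg_of_le
    (fun _ => abs_nonneg _) fun i => (abs_mixTerm_le h a _ i).trans_eq ?_
  rw [abs_pow, pow_add, mul_pow]
  ring

/-- By the binomial theorem the inner alternating sum is `x ^ N * (x - 1) ^ n`. At `x = 1 / (1 - s)`
one has `a * (x - 1) = a * s / (1 - s)`. -/
theorem hasSum_mixTerm_pow {N NR : ℕ} (h : N ≤ NR) (a x : ℝ) :
    HasSum (fun n => x ^ N * hypTerm N NR n (a * (x - 1)))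
      (∑' i, mixTerm N NR a (fun k => x ^ (N + k)) i) := by
  convert hasSum_hypTerm_mul_sum (summable_mixTerm_pow h a x).of_abs using 2 with n
  have hb : ∑ m ∈ Finset.range (n + 1), (n.choose m : ℝ) * ((-1) ^ m * x ^ (N + (n - m))) =
      x ^ N * (x - 1) ^ n := by
    rw [show x - 1 = -1 + x by ring, add_pow, Finset.mul_sum]
    exact Finset.sum_congr rfl fun m _ => by ring
  rw [hb, hypTerm_eq, hypTerm_eq, mul_pow]
  ring

theorem integrableOn_and_integral_exp_mul_snrPdf {N : ℕ} (hN : 1 ≤ N) (b : ℕ) (a : ℝ)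
    {s : ℝ} (hs : s < 1) :
    MeasureTheory.IntegrableOn (fun t => Real.exp (s * t) * snrPdf N (N + b) t a) (Set.Ioi 0) ∧
      ∫ t in Set.Ioi (0 : ℝ), Real.exp (s * t) * snrPdf N (N + b) t a = snrMgf N (N + b) s a := by
  have hle := N.le_add_right b
  set x : ℝ := 1 / (1 - s) with hx
  have hx0 : 0 < x := one_div_pos.2 (sub_pos.2 hs)
  set F : ℕ × ℕ → ℝ → ℝ := fun i t =>
    mixTerm N (N + b) a (fun _ => 1) i * (Real.exp (s * t) * gammaDensity N t i.2) with hF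
  have hpow : ∀ i, mixTerm N (N + b) a (fun _ => 1) i * x ^ (N + i.2) =
      mixTerm N (N + b) a (fun k => x ^ (N + k)) i := fun i => by simp only [mixTerm]; ring
  have hFint : ∀ i, MeasureTheory.IntegrableOn (F i) (Set.Ioi 0) := fun i =>
    (integrableOn_exp_mul_gammaDensity N i.2 hs).const_mul _
  have hFval : ∀ i, ∫ t in Set.Ioi (0 : ℝ), F i t =
      mixTerm N (N + b) a (fun k => x ^ (N + k)) i := fun i => by
    rw [MeasureTheory.integral_const_mul, integral_exp_mul_gammaDensity hN _ hs, ← hx, hpow]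
  have hFnorm : ∀ i, ∫ t in Set.Ioi (0 : ℝ), ‖F i t‖ =
      |mixTerm N (N + b) a (fun k => x ^ (N + k)) i| := fun i => by
    have h : ∀ t ∈ Set.Ioi (0 : ℝ), ‖F i t‖ = |mixTerm N (N + b) a (fun _ => 1) i| *
        (Real.exp (s * t) * gammaDensity N t i.2) := fun t ht => by
      rw [hF, norm_mul, Real.norm_eq_abs, Real.norm_eq_abs, abs_of_nonneg
        (mul_nonneg (Real.exp_pos _).le (gammaDensity_nonneg N _ (Set.mem_Ioi.1 ht).le))]
    rw [MeasureTheory.setIntegral_congr_fun measurableSet_Ioi h, MeasureTheory.integral_const_mul,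
      integral_exp_mul_gammaDensity hN _ hs, ← hx, ← hpow, abs_mul, abs_of_pos (pow_pos hx0 _)]
  have hsum : Summable fun i => ∫ t in Set.Ioi (0 : ℝ), ‖F i t‖ := by
    simpa only [hFnorm] using summable_mixTerm_pow hle a x
  have heq : ∀ t ∈ Set.Ioi (0 : ℝ),
      Real.exp (s * t) * snrPdf N (N + b) t a = ∑' i, F i t := fun t ht => by
    rw [snrPdf, (hasSum_pdfTerm hle a (Set.mem_Ioi.1 ht).le).tsum_eq, ← tsum_mul_left]
    exact tsum_congr fun i => exp_mul_mixTerm_eq _ _ _ _ _ _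
  -- Supplies the measurability of the sum, through the closed form.
  have hcont : ContinuousOn (fun t => Real.exp (s * t) * snrPdf N (N + b) t a) (Set.Ioi 0) :=
    (by fun_prop : ContinuousOn (fun t : ℝ => Real.exp (s * t)) (Set.Ioi 0)).mul
      (contDiffOn_snrPdf hN b a).continuousOn
  have hint := integrable_tsum_of_summable_integral_norm hFint hsum
    ((hcont.congr fun t ht => (heq t ht).symm).aestronglyMeasurable measurableSet_Ioi)
  refine ⟨(MeasureTheory.integrableOn_congr_fun heq measurableSet_Ioi).2 hint, ?_⟩
  rw [MeasureTheory.setIntegral_congr_fun measurableSet_Ioi heq,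
    ← (MeasureTheory.hasSum_integral_of_summable_integral_norm hFint hsum).tsum_eq]
  simp only [hFval]
  have h1s : 1 - s ≠ 0 := (sub_pos.2 hs).ne'
  rw [← (hasSum_mixTerm_pow hle a x).tsum_eq, tsum_mul_left, snrMgf, confluentHyp, hx,
    one_div_pow, show a * (1 / (1 - s) - 1) = a * s / (1 - s) by field_simp; ring]

theorem summable_hypTerm {N NR : ℕ} (h : N ≤ NR) (σ : ℝ) :
    Summable fun n => hypTerm N NR n σ := by
  simpa only [hypTerm_eq] using (summable_abs_pochRatio_mul_exp h σ).of_abs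

/-! ### The derivatives of the density in closed form -/

/-- The logarithmic derivative of `pdfWeight` in `t`. -/
def weightLogDeriv (N : ℕ) (t : ℝ) : ℝ := -1 + ((N : ℝ) - 1) / t

theorem hasDerivAt_weightLogDeriv (N : ℕ) {t : ℝ} (ht : t ≠ 0) :
    HasDerivAt (weightLogDeriv N) (-(((N : ℝ) - 1) / t ^ 2)) t := by
  have h := ((hasDerivAt_inv ht).const_mul ((N : ℝ) - 1)).const_add (-1)
  refine h.congr_deriv ?_
  field_simp

theorem hasDerivAt_exp_neg_mul_pow {N : ℕ} (hN : 1 ≤ N) {t : ℝ} (ht : t ≠ 0) :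
    HasDerivAt (fun τ => Real.exp (-τ) * τ ^ (N - 1))
      (Real.exp (-t) * t ^ (N - 1) * weightLogDeriv N t) t := by
  refine ((hasDerivAt_neg t).exp.mul (hasDerivAt_pow (N - 1) t)).congr_deriv ?_
  rw [weightLogDeriv]
  obtain ⟨m, rfl⟩ := Nat.exists_eq_add_of_le' hN
  rcases m with _ | m
  · simp
  · simp only [Nat.add_sub_cancel, pow_succ]
    push_cast
    field_simp
    ring

theorem hasDerivAt_pdfWeight {N : ℕ} (hN : 1 ≤ N) (b : ℕ) (a : ℝ) {t : ℝ} (ht : t ≠ 0) :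
    HasDerivAt (fun τ => pdfWeight N b τ a) (pdfWeight N b t a * weightLogDeriv N t) t :=
  ((hasDerivAt_exp_neg_mul_pow hN ht).const_mul _).congr_deriv (mul_assoc _ _ _).symm

theorem hasDerivAt_pdfWeight_line {N : ℕ} (hN : 1 ≤ N) (b : ℕ) (c : ℝ) {u : ℝ} (hu : u ≠ 0) :
    HasDerivAt (fun v => pdfWeight N b v (c * v))
      (pdfWeight N b u (c * u) * (weightLogDeriv N u - c)) u := by
  have h1 := ((((hasDerivAt_id u).const_mul c).neg.exp).const_mul
    (((N + b - 1).factorial : ℝ) / ((N - 1).factorial : ℝ))).mul (hasDerivAt_exp_neg_mul_pow hN hu)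
  refine h1.congr_deriv ?_
  simp only [pdfWeight, id, Pi.neg_apply]
  ring

/-- The closed form of the first `t`-derivative of the density. -/
def pdfDeriv (N b : ℕ) (t a : ℝ) : ℝ :=
  pdfWeight N b t a * (weightLogDeriv N t * humbert b (N + b) a (a * t) +
    a * humbert b (N + b + 1) a (a * t))

/-- The closed form of the second `t`-derivative of the density. -/
def pdfDeriv₂ (N b : ℕ) (t a : ℝ) : ℝ :=
  pdfWeight N b t a *
    ((weightLogDeriv N t ^ 2 - ((N : ℝ) - 1) / t ^ 2) * humbert b (N + b) a (a * t) +
      2 * weightLogDeriv N t * (a * humbert b (N + b + 1) a (a * t)) +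
      a ^ 2 * humbert b (N + b + 2) a (a * t))

theorem hasDerivAt_pdf {N : ℕ} (hN : 1 ≤ N) (b : ℕ) (a : ℝ) {t : ℝ} (ht : t ≠ 0) :
    HasDerivAt (fun τ => pdfWeight N b τ a * humbert b (N + b) a (a * τ)) (pdfDeriv N b t a) t := by
  refine ((hasDerivAt_pdfWeight hN b a ht).mul
    (hasDerivAt_humbert_mul_right b (N + b) a a t)).congr_deriv ?_
  rw [pdfDeriv]
  ring

theorem hasDerivAt_pdfDeriv {N : ℕ} (hN : 1 ≤ N) (b : ℕ) (a : ℝ) {t : ℝ} (ht : t ≠ 0) :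
    HasDerivAt (fun τ => pdfDeriv N b τ a) (pdfDeriv₂ N b t a) t := by
  refine ((hasDerivAt_pdfWeight hN b a ht).mul (((hasDerivAt_weightLogDeriv N ht).mul
    (hasDerivAt_humbert_mul_right b (N + b) a a t)).add
    ((hasDerivAt_humbert_mul_right b (N + b + 1) a a t).const_mul a))).congr_deriv ?_
  simp only [pdfDeriv₂, Pi.mul_apply, Pi.add_apply]
  ring

theorem pVec_eq {N : ℕ} (hN : 1 ≤ N) (b : ℕ) (a : ℝ) {t : ℝ} (ht : 0 < t) :
    pVec N (N + b) t a =
      ![pdfWeight N b t a * humbert b (N + b) a (a * t), pdfDeriv N b t a, pdfDeriv₂ N b t a] := by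
  have h1 : ∀ τ : ℝ, 0 < τ → deriv (fun τ => snrPdf N (N + b) τ a) τ = pdfDeriv N b τ a :=
    fun τ hτ => by
      rw [← (hasDerivAt_pdf hN b a hτ.ne').deriv]
      refine Filter.EventuallyEq.deriv_eq ?_
      filter_upwards [Ioi_mem_nhds hτ] with v hv using snrPdf_eq hN b a (Set.mem_Ioi.1 hv).le
  have h2 : deriv (deriv fun τ => snrPdf N (N + b) τ a) t = pdfDeriv₂ N b t a := by
    rw [← (hasDerivAt_pdfDeriv hN b a ht.ne').deriv]
    refine Filter.EventuallyEq.deriv_eq ?_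
    filter_upwards [Ioi_mem_nhds ht] with v hv using h1 v hv
  funext q
  fin_cases q
  · simpa [pVec] using snrPdf_eq hN b a ht.le
  · simpa [pVec, iteratedDeriv_one] using h1 t ht
  · simpa [pVec, iteratedDeriv_succ, iteratedDeriv_zero] using h2

/-! ### The system along a line -/

/-- The shift recursion precedes the Euler relation here: Euler at index `n` itself would bring in
index `n - 1`. The factor `x = c u` it produces cancels the division by `u`. -/
theorem hasDerivAt_humbert_line (b n : ℕ) (c : ℝ) {u : ℝ} (hu : u ≠ 0) :
    HasDerivAt (fun v => humbert b n (c * v) (c * v * v))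
      (c * (((b : ℝ) - n) * humbert b (n + 1) (c * u) (c * u * u) +
          humbert b n (c * u) (c * u * u) - c * u * u * humbert b (n + 2) (c * u) (c * u * u)) +
        2 * (c * u) * humbert b (n + 1) (c * u) (c * u * u)) u := by
  refine (hasDerivAt_humbert_parabola b n c hu).congr_deriv ?_
  rw [tsum_fst_mul_humbertTerm, tsum_fst_mul_humbertTerm_succ]
  field_simp
  ring

theorem hasDerivAt_humbert_succ_line (b n : ℕ) (c : ℝ) {u : ℝ} (hu : u ≠ 0) :
    HasDerivAt (fun v => humbert b (n + 1) (c * v) (c * v * v))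
      ((humbert b n (c * u) (c * u * u) - n * humbert b (n + 1) (c * u) (c * u * u)) / u +
        c * u * humbert b (n + 2) (c * u) (c * u * u)) u := by
  refine (hasDerivAt_humbert_parabola b (n + 1) c hu).congr_deriv ?_
  rw [tsum_fst_mul_humbertTerm_succ]
  field_simp
  ring

/-- Index `n + 3` appears with coefficient `c³ u³ = c x y`, so `c` times the contiguity relation
removes it. Keeping the prefactor `(c v) ^ 2` avoids dividing by `c`, which may be `0`. -/
theorem hasDerivAt_mul_humbert_succ_succ_line (b n : ℕ) (c : ℝ) {u : ℝ} (hu : u ≠ 0) :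
    HasDerivAt (fun v => (c * v) ^ 2 * humbert b (n + 2) (c * v) (c * v * v))
      (2 * c ^ 2 * u * humbert b (n + 2) (c * u) (c * u * u) +
        c ^ 2 * u * (humbert b (n + 1) (c * u) (c * u * u) -
          (n + 1) * humbert b (n + 2) (c * u) (c * u * u)) +
        c * ((n + c * u) * humbert b (n + 1) (c * u) (c * u * u) +
          (c * u * u + c * u * ((b : ℝ) - n - 1)) * humbert b (n + 2) (c * u) (c * u * u) -
          humbert b n (c * u) (c * u * u))) u := by
  refine ((((hasDerivAt_id u).const_mul c).pow 2).mul
    (hasDerivAt_humbert_succ_line b (n + 1) c hu)).congr_deriv ?_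
  have h := humbert_contiguous b n (c * u) (c * u * u)
  simp only [id, Pi.pow_apply, add_assoc n, Nat.reduceAdd]
  generalize humbert b n (c * u) (c * u * u) = k₀ at h ⊢
  generalize humbert b (n + 1) (c * u) (c * u * u) = k₁ at h ⊢
  generalize humbert b (n + 2) (c * u) (c * u * u) = k₂ at h ⊢
  generalize humbert b (n + 3) (c * u) (c * u * u) = k₃ at h ⊢
  push_cast
  field_simp
  linear_combination c * h

/-- Both sides are the weight times a combination of the same three `humbert` values, so each
component is an identity of rational functions of `u`. -/
theorem hasDerivAt_pLine {N : ℕ} (hN : 1 ≤ N) (b : ℕ) (c : ℝ) {u : ℝ} (hu : 0 < u) :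
    HasDerivAt (pLine N (N + b) c)
      ((lineMatrix N (N + b) c u).mulVec (pLine N (N + b) c u)) u := by
  have hu' := hu.ne'
  have hev : pLine N (N + b) c =ᶠ[nhds u] fun v =>
      ![pdfWeight N b v (c * v) * humbert b (N + b) (c * v) (c * v * v),
        pdfDeriv N b v (c * v), pdfDeriv₂ N b v (c * v)] := by
    filter_upwards [Ioi_mem_nhds hu] with v hv using pVec_eq hN b (c * v) hv
  refine HasDerivAt.congr_of_eventuallyEq ?_ hev
  rw [hev.self_of_nhds]
  have hw := hasDerivAt_pdfWeight_line hN b c hu'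
  have he := hasDerivAt_weightLogDeriv N hu'
  have h0 := hasDerivAt_humbert_line b (N + b) c hu'
  have h1 := ((hasDerivAt_id u).const_mul c).mul (hasDerivAt_humbert_succ_line b (N + b) c hu')
  have h2 := hasDerivAt_mul_humbert_succ_succ_line b (N + b) c hu'
  have hq := ((hasDerivAt_pow 2 u).inv (pow_ne_zero 2 hu')).const_mul ((N : ℝ) - 1)
  rw [hasDerivAt_pi]
  intro q
  fin_cases q
  · refine (hw.mul h0).congr_deriv ?_
    simp [lineMatrix, matP, matQ, pdfDeriv, pdfDeriv₂, Matrix.mulVec, dotProduct,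
      Fin.sum_univ_three, weightLogDeriv]
    field_simp
    ring
  · refine (hw.mul ((he.mul h0).add h1)).congr_deriv ?_
    simp [lineMatrix, matP, matQ, pdfDeriv, pdfDeriv₂, Matrix.mulVec, dotProduct,
      Fin.sum_univ_three, weightLogDeriv]
    field_simp
    ring
  · refine (hw.mul (((((he.pow 2).sub hq).mul h0).add ((he.const_mul 2).mul h1)).add
      h2)).congr_deriv ?_
    simp [lineMatrix, matP, matQ, pdfDeriv, pdfDeriv₂, Matrix.mulVec, dotProduct,
      Fin.sum_univ_three, weightLogDeriv]
    field_simp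
    ring

/-! ### Uniqueness of solutions -/

-- A bound of `‖A t‖` on the compact interval is a Lipschitz constant for the linear field; the `ℓ∞`
-- operator norm is the one matching the sup norm on `n → ℝ`.
attribute [local instance] Matrix.linftyOpNormedAddCommGroup in
theorem eqOn_of_hasDerivWithinAt_mulVec {n : Type*} [Fintype n] {A : ℝ → Matrix n n ℝ}
    {f g : ℝ → n → ℝ} {a b : ℝ} (hA : ∀ i j, ContinuousOn (fun t => A t i j) (Set.Icc a b))
    (hf : ∀ t ∈ Set.Icc a b, HasDerivWithinAt f ((A t).mulVec (f t)) (Set.Icc a b) t)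
    (hg : ∀ t ∈ Set.Icc a b, HasDerivWithinAt g ((A t).mulVec (g t)) (Set.Icc a b) t)
    (h : f a = g a) : Set.EqOn f g (Set.Icc a b) := by
  have hcont : ContinuousOn A (Set.Icc a b) :=
    continuousOn_pi.2 fun i => continuousOn_pi.2 fun j => hA i j
  obtain ⟨C, hC⟩ := isCompact_Icc.exists_bound_of_continuousOn hcont
  have hmono : ∀ F : ℝ → n → ℝ,
      (∀ t ∈ Set.Icc a b, HasDerivWithinAt F ((A t).mulVec (F t)) (Set.Icc a b) t) →
      ∀ t ∈ Set.Ico a b, HasDerivWithinAt F ((A t).mulVec (F t)) (Set.Ici t) t := fun F hF t ht =>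
    (hF t ⟨ht.1, ht.2.le⟩).mono_of_mem_nhdsWithin (Icc_mem_nhdsGE_of_mem ht)
  refine ODE_solution_unique_of_mem_Icc_right (v := fun t x => (A t).mulVec x) (K := C.toNNReal)
    (s := fun _ => Set.univ) (fun t ht => ?_)
    (fun t ht => (hf t ht).continuousWithinAt) (hmono f hf) (fun _ _ => Set.mem_univ _)
    (fun t ht => (hg t ht).continuousWithinAt) (hmono g hg) (fun _ _ => Set.mem_univ _) h
  refine (LipschitzWith.of_dist_le_mul fun x y => ?_).lipschitzOnWith
  rw [dist_eq_norm, dist_eq_norm, ← Matrix.mulVec_sub]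
  refine (Matrix.linfty_opNorm_mulVec (A t) (x - y)).trans ?_
  gcongr
  exact (hC t ⟨ht.1, ht.2.le⟩).trans (Real.le_coe_toNNReal C)

theorem continuousOn_lineMatrix (N NR : ℕ) (c : ℝ) (i j : Fin 3) :
    ContinuousOn (fun u => lineMatrix N NR c u i j) (Set.Ioi 0) := by
  intro u hu
  have hu : u ≠ 0 := (Set.mem_Ioi.1 hu).ne'
  have hu2 : u ^ 2 ≠ 0 := pow_ne_zero 2 hu
  refine ContinuousAt.continuousWithinAt ?_
  fin_cases i <;> fin_cases j <;> simp [lineMatrix, matP, matQ] <;> fun_prop (disch := assumption)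

end ZFSNR

end

theorem mainTheorem6 (NT NR N : ℕ) (hNT : 1 ≤ NT) (hNR : NT ≤ NR) (hN : N = NR - NT + 1) :
    -- the series converges and is a smooth probability density on `(0, ∞)` with m.g.f. `M(·, a)`
    (∀ a : ℝ, 0 ≤ a →
      (∀ t : ℝ, 0 < t → Summable (ZFSNR.pdfTerm N NR t a) ∧ 0 ≤ ZFSNR.snrPdf N NR t a) ∧
      ContDiffOn ℝ ∞ (fun t => ZFSNR.snrPdf N NR t a) (Set.Ioi 0) ∧
      ∀ s : ℝ, s < 1 →
        Summable (fun n => ZFSNR.hypTerm N NR n (a * s / (1 - s))) ∧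
        MeasureTheory.IntegrableOn
          (fun t => Real.exp (s * t) * ZFSNR.snrPdf N NR t a) (Set.Ioi 0) ∧
        ∫ t in Set.Ioi (0 : ℝ), Real.exp (s * t) * ZFSNR.snrPdf N NR t a =
          ZFSNR.snrMgf N NR s a) ∧
    ∀ c : ℝ, 0 ≤ c →
      -- the system of differential equations on the line `a = c t`
      (∀ u : ℝ, 0 < u →
        HasDerivAt (ZFSNR.pLine N NR c)
          ((ZFSNR.lineMatrix N NR c u).mulVec (ZFSNR.pLine N NR c u)) u) ∧
      -- solving that system from the initial condition at `u₀` returns the function vector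
      (∀ u₀ u₁ : ℝ, 0 < u₀ → u₀ ≤ u₁ → ∀ y : ℝ → Fin 3 → ℝ,
        y u₀ = ZFSNR.pLine N NR c u₀ →
        (∀ u ∈ Set.Icc u₀ u₁,
          HasDerivWithinAt y ((ZFSNR.lineMatrix N NR c u).mulVec (y u)) (Set.Icc u₀ u₁) u) →
        Set.EqOn y (ZFSNR.pLine N NR c) (Set.Icc u₀ u₁)) := by
  obtain ⟨b, rfl⟩ : ∃ b, NR = N + b := ⟨NT - 1, by omega⟩
  have hN1 : 1 ≤ N := by omega
  have hle := N.le_add_right b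
  refine ⟨fun a ha => ⟨fun t ht => ⟨(ZFSNR.hasSum_pdfTerm hle a ht.le).summable,
    ZFSNR.snrPdf_nonneg hN1 b ha ht.le⟩, ZFSNR.contDiffOn_snrPdf hN1 b a, fun s hs =>
    ⟨ZFSNR.summable_hypTerm hle _, ZFSNR.integrableOn_and_integral_exp_mul_snrPdf hN1 b a hs⟩⟩,
    fun c _ => ⟨fun u hu => ZFSNR.hasDerivAt_pLine hN1 b c hu, fun u₀ u₁ hu₀ _ y hy hy' => ?_⟩⟩
  exact ZFSNR.eqOn_of_hasDerivWithinAt_mulVec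
    (fun i j => (ZFSNR.continuousOn_lineMatrix N (N + b) c i j).mono
      fun u hu => hu₀.trans_le hu.1) hy'
    (fun u hu => (ZFSNR.hasDerivAt_pLine hN1 b c (hu₀.trans_le hu.1)).hasDerivWithinAt) hy
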